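/- \textbf{Setting.} Let $\mathcal M=\langle \mathcal S,\mathcal A,H,\mathcal P,r,g,s_1\rangle$ be an episodic constrained MDP with horizon $H\ge 1$, transition kernel $\mathcal P$, reward $r:\mathcal S\times\mathcal A\to[0,1]$, safety cost $g:\mathcal S\times\mathcal A\to[0,1]$, initial state $s_1$ and reward discount factor $\gamma_r\in(0,1]$. Put $V_{\max}=\sum_{i=0}^{H-1}\gamma_r^i$ and, for $Q:\mathcal S\times\mathcal A\to\mathbb R$, $\mathcal T(Q)(s,a)=r(s,a)+\gamma_r\,\mathbb E_{s'\sim\mathcal P(\cdot\mid s,a)}[\max_{a'}Q(s',a')]$. Let $d\ge 1$, let $\phi:\mathcal S\times\mathcal A\to\mathbb R^d$ be a feature map with $\|\phi_{s,a}\|_2\le 1$, and let $f:[-1,1]\to[-1,1]$ be a \emph{regular link function}: $f$ is monotone (increasing or decreasing) and twice differentiable, and $\underline\kappa<|f'(x)|<\overline\kappa$ and $|f''(x)|<M$ for all $|x|\le 1$, where $0<\underline\kappa<\overline\kappa<\infty$ and $M<\infty$. Put $\mathcal F=\{(s,a)\mapsto f(\langle\phi_{s,a},\theta\rangle):\|\theta\|_2\le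 1\}$ and, with $\|x\|_A=\sqrt{x^\top A x}$ and a constant $\alpha_{\max}>0$, $$\mathcal F_{\mathrm{up}}=\bigl\{(s,a)\mapsto\min\{V_{\max},\,f(\langle\phi_{s,a},\theta\rangle)+\alpha\|\phi_{s,a}\|_A\}:\ \|\theta\|_2\le1,\ 0\le\alpha\le\alpha_{\max},\ A\succeq0,\ \|A\|_{\mathrm{op}}\le1\bigr\}.$$ Assume that $\mathcal M$ is a \emph{generalized linear CMDP}: $g\in\mathcal F$, and $\mathcal T(u)\in\mathcal F$ at every step $1\le h<H$ for every $u\in\mathcal F_{\mathrm{up}}$. \textbf{Algorithm (GLM-MASE).} Let $T\ge1$ be the number of episodes, $\delta=\frac1{TH}$, and for a constant $C>0$ let $C_g=C\,\overline\kappa\,\underline\kappa^{-1}\sqrt{1+M+\overline\kappa+d^2\ln\bigl(\frac{1+\overline\kappa+\alpha_{\max}}{\delta}\bigr)}$. Let $s_h^{(t)},a_h^{(t)}$ be the state and action at step $h$ of episode $t$, let $b_h^{(t)}\in\mathbb R$ (abbreviated $b_h$) be the threshold, revealed at that step and possibly depending on the past, and put $\widetilde\phi_h^{(\tau)}=\phi(s_h^{(\tau)},a_h^{(\tau)})$.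 For $0\le t\le T$, with all sums over those $\tau$ with $1\le\tau\le t$ for which an action was executed at step $h$ of episode $\tau$, set $$\widehat\theta^g_{h,t}\in\operatorname*{arg\,min}_{\|\theta\|_2\le1}\sum_{\tau\le t}\bigl(g(s_h^{(\tau)},a_h^{(\tau)})-f(\langle\widetilde\phi_h^{(\tau)},\theta\rangle)\bigr)^2,\qquad \Lambda_{h,t}=I+\sum_{\tau\le t}\widetilde\phi_h^{(\tau)}(\widetilde\phi_h^{(\tau)})^\top,$$ $\Gamma_{h,t}(s,a)=C_g\|\phi_{s,a}\|_{\Lambda_{h,t}^{-1}}$, and $$\mathcal A^{+}_{h,t}(s,b)=\bigl\{a\in\mathcal A:\ \min\{1,\ f(\langle\phi_{s,a},\widehat\theta^g_{h,t}\rangle)+\Gamma_{h,t}(s,a)\}\le b\bigr\}.$$ With constants $C_{Q/g},c>0$, put $\widehat Q^{(0)}_h=0$ for all $h$, $\widehat Q^{(t)}_{H+1}=0$ for all $t$, and for $1\le t\le T$, $1\le h\le H$, $$\widehat Q^{(t)}_h(s,a)=\min\{V_{\max},\,f(\langle\phi_{s,a},\widehat\theta^Q_{h,t}\rangle)+C_{Q/g}\Gamma_{h,t}(s,a)\},$$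 where $\widehat\theta^Q_{h,t}$ minimizes $\sum_{\tau\le t}\bigl(\widehat r_{h,t}^{(\tau)}+\max_{a'}\widehat Q^{(\tau)}_{h+1}(s^{(\tau)}_{h+1},a')-f(\langle\widetilde\phi_h^{(\tau)},\theta\rangle)\bigr)^2$ over $\|\theta\|_2\le1$. Here $\widehat r_{h,t}^{(\tau)}=-c/\min_{a}\Gamma_{h+1,t-1}(s^{(\tau)}_{h+1},a)$ if $h<H$ and $\mathcal A^+_{h+1,t-1}(s^{(\tau)}_{h+1},b^{(\tau)}_{h+1})=\emptyset$ (with the convention $-c/0=0$), and $\widehat r_{h,t}^{(\tau)}=r(s^{(\tau)}_h,a^{(\tau)}_h)$ otherwise. Episode $t$ starts at $s_1$. At step $h=1,\dots,H$, if $\mathcal A^+_{h,t-1}(s_h^{(t)},b_h^{(t)})=\emptyset$, the emergency stop is executed: the episode ends with no further action, and the environment is reset to $s_1$. Otherwise the agent executes an action $a_h^{(t)}$ maximizing $\widehat Q^{(t-1)}_h(s_h^{(t)},\cdot)$ over $\mathcal A^+_{h,t-1}(s_h^{(t)},b_h^{(t)})$, and the next state is drawn from $\mathcal P(\cdot\mid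 s_h^{(t)},a_h^{(t)})$ given the past. Ties in all minimizations and maximizations are broken arbitrarily. \textbf{Theorem.} There is a universal constant $C>0$ such that, in every such setting and for every run of GLM-MASE with this $C$, with probability at least $1-\delta$, $$g(s_h^{(t)},a_h^{(t)})\le b_h^{(t)}\quad\text{for all episodes }t\in[1,T]\text{ and all steps }h\in[1,H]$$ at which an action is executed, i.e. those not cut off by an emergency stop. -/

import Mathlib

open MeasureTheory Set

namespace GLMMase

noncomputable section

/-- Feature space `ℝ^d` with the Euclidean norm. -/
abbrev Vec (d : ℕ) := EuclideanSpace ℝ (Fin d)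

/-- The `d × d` real matrices. -/
abbrev Mat (d : ℕ) := Matrix (Fin d) (Fin d) ℝ

/-- Episodic constrained Markov decision process `⟨S, A, H, P, r, g, s₁⟩`, with reward discount
factor `γ`. -/
structure CMDP (S A : Type*) [MeasurableSpace S] [MeasurableSpace A] where
  H : ℕ
  H_pos : 0 < H
  P : ProbabilityTheory.Kernel (S × A) S
  markov : ProbabilityTheory.IsMarkovKernel P
  r : S → A → ℝ
  r_meas : Measurable (Function.uncurry r)
  r_mem : ∀ s a, r s a ∈ Icc (0 : ℝ) 1
  g : S → A → ℝ
  g_meas : Measurable (Function.uncurry g)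
  g_mem : ∀ s a, g s a ∈ Icc (0 : ℝ) 1
  s₁ : S
  γ : ℝ
  γ_pos : 0 < γ
  γ_le : γ ≤ 1

/-- `V_max = 1 + γ + ⋯ + γ^(H-1)`, that is `(1 - γ^H) / (1 - γ)`, and `H` when `γ = 1`. -/
def CMDP.Vmax {S A : Type*} [MeasurableSpace S] [MeasurableSpace A] (𝓜 : CMDP S A) : ℝ :=
  ∑ i ∈ Finset.range 𝓜.H, 𝓜.γ ^ i

/-- Bellman update `𝒯(Q)(s, a) = r(s, a) + γ 𝔼[max_{a'} Q(s', a')]` with `s' ∼ P(· | s, a)`. The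
reward and the kernel are stationary, so it is the same at every step. -/
def CMDP.bellman {S A : Type*} [MeasurableSpace S] [MeasurableSpace A] (𝓜 : CMDP S A)
    (Q : S → A → ℝ) (s : S) (a : A) : ℝ :=
  𝓜.r s a + 𝓜.γ * ∫ s', (⨆ a', Q s' a') ∂(𝓜.P (s, a))

/-- Regular link function `f : [-1, 1] → [-1, 1]`; derivatives at the end points are one-sided. -/
structure RegularLink (f : ℝ → ℝ) (κlo κhi M : ℝ) : Prop where
  mapsTo : MapsTo f (Icc (-1) 1) (Icc (-1) 1)
  diff : DifferentiableOn ℝ f (Icc (-1) 1)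
  diff_deriv : DifferentiableOn ℝ (derivWithin f (Icc (-1) 1)) (Icc (-1) 1)
  mono : MonotoneOn f (Icc (-1) 1) ∨ AntitoneOn f (Icc (-1) 1)
  κlo_pos : 0 < κlo
  κlo_lt : κlo < κhi
  deriv_lower : ∀ x ∈ Icc (-1 : ℝ) 1, κlo < |derivWithin f (Icc (-1) 1) x|
  deriv_upper : ∀ x ∈ Icc (-1 : ℝ) 1, |derivWithin f (Icc (-1) 1) x| < κhi
  deriv2_lt : ∀ x ∈ Icc (-1 : ℝ) 1,
    |derivWithin (derivWithin f (Icc (-1) 1)) (Icc (-1) 1) x| < M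

/-- Feature map into the Euclidean unit ball. -/
structure FeatureMap {S A : Type*} [MeasurableSpace S] [MeasurableSpace A] {d : ℕ}
    (φ : S → A → Vec d) : Prop where
  meas : Measurable (Function.uncurry φ)
  norm_le : ∀ s a, ‖φ s a‖ ≤ 1

/-- The function `(s, a) ↦ f ⟨φ(s, a), θ⟩`. -/
def glm {S A : Type*} {d : ℕ} (φ : S → A → Vec d) (f : ℝ → ℝ) (θ : Vec d) (s : S) (a : A) : ℝ :=
  f (inner ℝ (φ s a) θ)

/-- Generalized linear model class `ℱ`. -/
def glmClass {S A : Type*} {d : ℕ} (φ : S → A → Vec d) (f : ℝ → ℝ) : Set (S → A → ℝ) :=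
  {u | ∃ θ : Vec d, ‖θ‖ ≤ 1 ∧ u = glm φ f θ}

/-- Mahalanobis seminorm `√(xᵀ B x)`. -/
def mahalanobis {d : ℕ} (B : Mat d) (x : Vec d) : ℝ :=
  √(x.ofLp ⬝ᵥ (B.mulVec x.ofLp))

/-- The class `ℱ_up` of capped generalized linear functions with an added bonus. -/
def upClass {S A : Type*} {d : ℕ} (φ : S → A → Vec d) (f : ℝ → ℝ) (Vmax αmax : ℝ) :
    Set (S → A → ℝ) :=
  {u | ∃ (θ : Vec d) (α : ℝ) (B : Mat d), ‖θ‖ ≤ 1 ∧ 0 ≤ α ∧ α ≤ αmax ∧ B.PosSemidef ∧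
    ‖Matrix.toEuclideanCLM (𝕜 := ℝ) B‖ ≤ 1 ∧
    u = fun s a => min Vmax (glm φ f θ s a + α * mahalanobis B (φ s a))}

/-- Generalized linear CMDP: optimistic closure of the Bellman update, and `g ∈ ℱ`. -/
structure IsGLCMDP {S A : Type*} [MeasurableSpace S] [MeasurableSpace A] {d : ℕ}
    (𝓜 : CMDP S A) (φ : S → A → Vec d) (f : ℝ → ℝ) (αmax : ℝ) : Prop where
  closure : ∀ h : ℕ, 1 ≤ h → h < 𝓜.H →
    ∀ u ∈ upClass φ f 𝓜.Vmax αmax, 𝓜.bellman u ∈ glmClass φ f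
  cost_mem : 𝓜.g ∈ glmClass φ f

/-- The coefficient `C_g`. -/
def costCoeff (C κlo κhi M αmax δ : ℝ) (d : ℕ) : ℝ :=
  C * κhi * κlo⁻¹ * √(1 + M + κhi + (d : ℝ) ^ 2 * Real.log ((1 + κhi + αmax) / δ))

/-- Record of all the episodes. Episodes `t` and steps `h` are counted from `1`.
`state t h`, `action t h`, `threshold t h` are `s_h^(t)`, `a_h^(t)`, `b_h^(t)`;
`len t` is the number of actions executed in episode `t` before its end or its emergency stop
(entries at later steps carry no meaning, except for the state and the threshold at step
`len t + 1 ≤ H`, where the emergency stop occurs);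
`thetaG h t`, `thetaQ h t` are the estimates for step `h` from the data of episodes `1, …, t`. -/
structure Trajectory (S A : Type*) (d : ℕ) where
  state : ℕ → ℕ → S
  action : ℕ → ℕ → A
  threshold : ℕ → ℕ → ℝ
  len : ℕ → ℕ
  thetaG : ℕ → ℕ → Vec d
  thetaQ : ℕ → ℕ → Vec d

namespace Trajectory

variable {S A : Type*} {d : ℕ}

/-- The episodes among `1, …, t` in which an action was executed at step `h`. -/
def visits (x : Trajectory S A d) (h t : ℕ) : Finset ℕ :=
  (Finset.Icc 1 t).filter (fun τ => h ≤ x.len τ)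

/-- `Λ_{h,t} = I + ∑_{τ ≤ t} φ_h^(τ) (φ_h^(τ))ᵀ`. -/
def gram (φ : S → A → Vec d) (x : Trajectory S A d) (h t : ℕ) : Mat d :=
  1 + ∑ τ ∈ x.visits h t, Matrix.vecMulVec (φ (x.state τ h) (x.action τ h)).ofLp
    (φ (x.state τ h) (x.action τ h)).ofLp

/-- `Γ_{h,t}(s, a) = C_g ‖φ(s, a)‖_{Λ_{h,t}⁻¹}`. -/
def width (φ : S → A → Vec d) (Cg : ℝ) (x : Trajectory S A d) (h t : ℕ) (s : S) (a : A) : ℝ :=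
  Cg * mahalanobis (x.gram φ h t)⁻¹ (φ s a)

/-- Least-squares objective of the safety-cost estimate. -/
def lossG (φ : S → A → Vec d) (f : ℝ → ℝ) (g : S → A → ℝ) (x : Trajectory S A d) (h t : ℕ)
    (θ : Vec d) : ℝ :=
  ∑ τ ∈ x.visits h t,
    (g (x.state τ h) (x.action τ h) - glm φ f θ (x.state τ h) (x.action τ h)) ^ 2

/-- The set of actions `a` with `min {1, μ(s, a) + Γ(s, a)} ≤ b` at state `s` and step `h`, where
`μ` and `Γ` are formed from the data of episodes `1, …, t`. -/
def safeSet (φ : S → A → Vec d) (f : ℝ → ℝ) (Cg : ℝ) (x : Trajectory S A d) (h t : ℕ) (s : S)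
    (b : ℝ) : Set A :=
  {a | min 1 (glm φ f (x.thetaG h t) s a + x.width φ Cg h t s a) ≤ b}

open Classical in
/-- Modified reward of step `h` of episode `τ`, evaluated with the safety estimates formed from the
data of episodes `1, …, t`: a penalty if no action was safe at the next step. -/
def modReward [MeasurableSpace S] [MeasurableSpace A] (𝓜 : CMDP S A) (φ : S → A → Vec d)
    (f : ℝ → ℝ) (Cg c : ℝ) (x : Trajectory S A d) (t τ h : ℕ) : ℝ :=
  if h < 𝓜.H ∧
      x.safeSet φ f Cg (h + 1) t (x.state τ (h + 1)) (x.threshold τ (h + 1)) = ∅ then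
    -c / ⨅ a, x.width φ Cg (h + 1) t (x.state τ (h + 1)) a
  else 𝓜.r (x.state τ h) (x.action τ h)

/-- Optimistic estimate `Q̂_h^(t)`, which vanishes for `t = 0` and at step `H + 1`. -/
def optQ [MeasurableSpace S] [MeasurableSpace A] (𝓜 : CMDP S A) (φ : S → A → Vec d)
    (f : ℝ → ℝ) (Cg CQ : ℝ) (x : Trajectory S A d) (h t : ℕ) (s : S) (a : A) : ℝ :=
  if t = 0 ∨ 𝓜.H < h then 0
  else min 𝓜.Vmax (glm φ f (x.thetaQ h t) s a + CQ * x.width φ Cg h t s a)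

/-- Least-squares objective of the Q-estimate made at the end of episode `t`. The regression target
of episode `τ` is `r̂_h^(τ) + max_{a'} Q̂_{h+1}^(τ)(s_{h+1}^(τ), a')`; the rewards in the
replay buffer are those rewritten with the safety estimates in use during episode `t`. -/
def lossQ [MeasurableSpace S] [MeasurableSpace A] (𝓜 : CMDP S A) (φ : S → A → Vec d)
    (f : ℝ → ℝ) (Cg CQ c : ℝ) (x : Trajectory S A d) (h t : ℕ) (θ : Vec d) : ℝ :=
  ∑ τ ∈ x.visits h t,
    (x.modReward 𝓜 φ f Cg c (t - 1) τ h
      + (⨆ a', x.optQ 𝓜 φ f Cg CQ (h + 1) τ (x.state τ (h + 1)) a')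
      - glm φ f θ (x.state τ h) (x.action τ h)) ^ 2

/-- `x` is produced by `T` episodes of GLM-MASE. In episode `t` the agent uses the estimates made
at the end of episode `t - 1`. -/
structure FollowsGLMMase [MeasurableSpace S] [MeasurableSpace A] (𝓜 : CMDP S A)
    (φ : S → A → Vec d) (f : ℝ → ℝ) (Cg CQ c : ℝ) (T : ℕ) (x : Trajectory S A d) : Prop where
  /-- Every episode starts in `s₁`, also after an emergency stop. -/
  start : ∀ t ∈ Finset.Icc 1 T, x.state t 1 = 𝓜.s₁
  len_le : ∀ t ∈ Finset.Icc 1 T, x.len t ≤ 𝓜.H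
  /-- Executed actions are safe according to the current estimates. -/
  action_safe : ∀ t ∈ Finset.Icc 1 T, ∀ h ∈ Finset.Icc 1 (x.len t),
    x.action t h ∈ x.safeSet φ f Cg h (t - 1) (x.state t h) (x.threshold t h)
  /-- Among these, an executed action maximizes the optimistic Q-estimate. -/
  action_opt : ∀ t ∈ Finset.Icc 1 T, ∀ h ∈ Finset.Icc 1 (x.len t),
    ∀ a ∈ x.safeSet φ f Cg h (t - 1) (x.state t h) (x.threshold t h),
      x.optQ 𝓜 φ f Cg CQ h (t - 1) (x.state t h) a
        ≤ x.optQ 𝓜 φ f Cg CQ h (t - 1) (x.state t h) (x.action t h)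
  /-- The emergency stop is only taken when there is no safe action. -/
  halt_only : ∀ t ∈ Finset.Icc 1 T, x.len t < 𝓜.H →
    x.safeSet φ f Cg (x.len t + 1) (t - 1) (x.state t (x.len t + 1))
      (x.threshold t (x.len t + 1)) = ∅
  /-- Constrained least-squares estimate of the safety cost (any point of the ball for `t = 0`). -/
  thetaG_argmin : ∀ t ≤ T, ∀ h ∈ Finset.Icc 1 𝓜.H, ‖x.thetaG h t‖ ≤ 1 ∧
    ∀ θ : Vec d, ‖θ‖ ≤ 1 → x.lossG φ f 𝓜.g h t (x.thetaG h t) ≤ x.lossG φ f 𝓜.g h t θ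
  /-- Constrained least-squares estimate of the Q-function. -/
  thetaQ_argmin : ∀ t ∈ Finset.Icc 1 T, ∀ h ∈ Finset.Icc 1 𝓜.H, ‖x.thetaQ h t‖ ≤ 1 ∧
    ∀ θ : Vec d, ‖θ‖ ≤ 1 →
      x.lossQ 𝓜 φ f Cg CQ c h t (x.thetaQ h t) ≤ x.lossQ 𝓜 φ f Cg CQ c h t θ

end Trajectory

/-- Information available after the action of step `h` of episode `t`: the states, actions and
thresholds so far, and the estimates made at the end of earlier episodes. -/
@[reducible] def history {S A Ω : Type*} [MeasurableSpace S] [MeasurableSpace A] {d : ℕ}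
    (X : Ω → Trajectory S A d) (t h : ℕ) : MeasurableSpace Ω :=
  (⨆ p ∈ {p : ℕ × ℕ | p.1 < t ∨ (p.1 = t ∧ p.2 ≤ h)},
    (MeasurableSpace.comap (fun ω => (X ω).state p.1 p.2) inferInstance ⊔
     MeasurableSpace.comap (fun ω => (X ω).action p.1 p.2) inferInstance ⊔
     MeasurableSpace.comap (fun ω => (X ω).threshold p.1 p.2) inferInstance)) ⊔
  (⨆ p ∈ {p : ℕ × ℕ | p.2 < t},
    (MeasurableSpace.comap (fun ω => (X ω).thetaG p.1 p.2) inferInstance ⊔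
     MeasurableSpace.comap (fun ω => (X ω).thetaQ p.1 p.2) inferInstance))

/-- The random trajectory `X` is generated by running `T` episodes of GLM-MASE in the CMDP `𝓜`:
each executed action is followed by a next state drawn from `P(· | s, a)` given the past. -/
structure IsGLMMaseProcess {S A Ω : Type*} [MeasurableSpace S] [MeasurableSpace A]
    [MeasurableSpace Ω] {d : ℕ} (𝓜 : CMDP S A) (φ : S → A → Vec d) (f : ℝ → ℝ)
    (Cg CQ c : ℝ) (T : ℕ) (μ : Measure Ω) (X : Ω → Trajectory S A d) : Prop where
  state_meas : ∀ t h, Measurable fun ω => (X ω).state t h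
  action_meas : ∀ t h, Measurable fun ω => (X ω).action t h
  threshold_meas : ∀ t h, Measurable fun ω => (X ω).threshold t h
  len_meas : ∀ t, Measurable fun ω => (X ω).len t
  thetaG_meas : ∀ h t, Measurable fun ω => (X ω).thetaG h t
  thetaQ_meas : ∀ h t, Measurable fun ω => (X ω).thetaQ h t
  follows : ∀ᵐ ω ∂μ, (X ω).FollowsGLMMase 𝓜 φ f Cg CQ c T
  transition : ∀ t ∈ Finset.Icc 1 T, ∀ h ∈ Finset.Icc 1 𝓜.H, ∀ B : Set S, MeasurableSet B →
    ∀ᵐ ω ∂μ, h ≤ (X ω).len t →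
      (μ[((fun ω' => (X ω').state t (h + 1)) ⁻¹' B).indicator (fun _ => (1 : ℝ)) |
        history X t h]) ω = (𝓜.P ((X ω).state t h, (X ω).action t h)).real B

end

end GLMMase

/-! The safety costs enter the regression without noise and `g` lies in the model class, so the true
parameter θ* has zero loss and every constrained minimizer θ̂ fits all past costs exactly. The link
is injective on [-1, 1], hence v = θ* - θ̂ is orthogonal to every visited feature, and the Gram
matrix Λ fixes v, as does its inverse. Cauchy–Schwarz for the form of Λ⁻¹ then gives |⟨φ, v⟩| ≤ ‖v‖
‖φ‖_{Λ⁻¹} with ‖v‖ ≤ 2, and the Lipschitz bound on `f` makes the error at most 2 κhi ‖φ‖_{Λ⁻¹}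
(`Trajectory.le_glm_add_width`). With C = 2 the bonus dominates this error, since the other factors
of `costCoeff` beyond κhi are at least 1. The confidence bound is thus deterministic: no
concentration argument is needed, and safety holds almost surely. -/

namespace GLMMase

/-! ### Slope bounds for the link function -/

/-- Mean value theorem for a link function, with one-sided derivatives at the end points. -/
theorem RegularLink.exists_slope {f : ℝ → ℝ} {κlo κhi M : ℝ} (hf : RegularLink f κlo κhi M)
    {x y : ℝ} (hx : x ∈ Icc (-1 : ℝ) 1) (hy : y ∈ Icc (-1 : ℝ) 1) :
    ∃ k : ℝ, κlo < |k| ∧ |k| < κhi ∧ f y - f x = k * (y - x) := by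
  have key : ∀ x ∈ Icc (-1 : ℝ) 1, ∀ y ∈ Icc (-1 : ℝ) 1, x < y →
      ∃ k : ℝ, κlo < |k| ∧ |k| < κhi ∧ f y - f x = k * (y - x) := by
    intro x hx y hy hxy
    have hsub : Icc x y ⊆ Icc (-1 : ℝ) 1 := Icc_subset_Icc hx.1 hy.2
    have hnhds : ∀ z ∈ Ioo x y, Icc (-1 : ℝ) 1 ∈ nhds z := fun z hz =>
      Icc_mem_nhds (hx.1.trans_lt hz.1) (hz.2.trans_le hy.2)
    obtain ⟨z, hz, hslope⟩ := exists_deriv_eq_slope f hxy (hf.diff.continuousOn.mono hsub)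
      (fun z hz => ((hf.diff z (hsub (Ioo_subset_Icc_self hz))).differentiableAt
        (hnhds z hz)).differentiableWithinAt)
    have hz' := hsub (Ioo_subset_Icc_self hz)
    -- The mean value point is interior to [-1, 1], so the bounds on the one-sided derivative apply
    -- there.
    rw [← derivWithin_of_mem_nhds (hnhds z hz)] at hslope
    refine ⟨_, hf.deriv_lower z hz', hf.deriv_upper z hz', ?_⟩
    rw [hslope, div_mul_cancel₀ _ (sub_ne_zero.2 hxy.ne')]
  rcases lt_trichotomy x y with h | h | h
  · exact key x hx y hy h
  · subst h
    exact ⟨_, hf.deriv_lower x hx, hf.deriv_upper x hx, by simp⟩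
  · obtain ⟨k, h1, h2, h3⟩ := key y hy x hx h
    exact ⟨k, h1, h2, by linarith⟩

/-- Slopes are bounded away from 0. This turns equality of fitted costs into equality of inner
products. -/
theorem RegularLink.injOn {f : ℝ → ℝ} {κlo κhi M : ℝ} (hf : RegularLink f κlo κhi M) :
    InjOn f (Icc (-1) 1) := by
  intro x hx y hy hxy
  obtain ⟨k, hk, -, h⟩ := hf.exists_slope hx hy
  rw [hxy, sub_self] at h
  have hk0 : k ≠ 0 := abs_pos.1 (hf.κlo_pos.trans hk)
  have := (mul_eq_zero.1 h.symm).resolve_left hk0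
  linarith

theorem RegularLink.abs_sub_le {f : ℝ → ℝ} {κlo κhi M : ℝ} (hf : RegularLink f κlo κhi M)
    {x y : ℝ} (hx : x ∈ Icc (-1 : ℝ) 1) (hy : y ∈ Icc (-1 : ℝ) 1) :
    |f y - f x| ≤ κhi * |y - x| := by
  obtain ⟨k, -, hk, h⟩ := hf.exists_slope hx hy
  rw [h, abs_mul]
  gcongr

/-- Since `f` maps `[-1, 1]` to itself, its slope cannot be everywhere above `1`. -/
theorem RegularLink.κlo_lt_one {f : ℝ → ℝ} {κlo κhi M : ℝ} (hf : RegularLink f κlo κhi M) :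
    κlo < 1 := by
  have h0 : (-1 : ℝ) ∈ Icc (-1 : ℝ) 1 := by simp
  have h1 : (1 : ℝ) ∈ Icc (-1 : ℝ) 1 := by simp
  obtain ⟨k, hk, -, h⟩ := hf.exists_slope h0 h1
  have a0 := hf.mapsTo h0
  have a1 := hf.mapsTo h1
  have : |k| ≤ 1 := abs_le.2 ⟨by linarith [a0.1, a0.2, a1.1, a1.2],
    by linarith [a0.1, a0.2, a1.1, a1.2]⟩
  linarith

/-- Both κlo⁻¹ and the square root are at least 1, so only the factor C κhi matters. -/
theorem RegularLink.two_mul_le_costCoeff {f : ℝ → ℝ} {κlo κhi M : ℝ}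
    (hf : RegularLink f κlo κhi M) {αmax δ : ℝ} (hα : 0 < αmax) (hδ : 0 < δ) (hδ1 : δ ≤ 1)
    (d : ℕ) : 2 * κhi ≤ costCoeff 2 κlo κhi M αmax δ d := by
  have hM : 0 < M := (abs_nonneg _).trans_lt (hf.deriv2_lt 0 (by simp))
  have hκ : 0 < κhi := hf.κlo_pos.trans hf.κlo_lt
  -- The argument of the logarithm is at least 1, because δ ≤ 1 ≤ 1 + κhi + αmax.
  have hlog : 0 ≤ Real.log ((1 + κhi + αmax) / δ) :=
    Real.log_nonneg ((one_le_div hδ).2 (by linarith))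
  have hsqrt : 1 ≤ √(1 + M + κhi + (d : ℝ) ^ 2 * Real.log ((1 + κhi + αmax) / δ)) := by
    rw [Real.one_le_sqrt]
    have := mul_nonneg (sq_nonneg (d : ℝ)) hlog
    linarith
  have hinv : 1 ≤ κlo⁻¹ := (one_le_inv₀ hf.κlo_pos).2 hf.κlo_lt_one.le
  have h1 : 1 ≤ κlo⁻¹ * √(1 + M + κhi + (d : ℝ) ^ 2 * Real.log ((1 + κhi + αmax) / δ)) :=
    one_le_mul_of_one_le_of_one_le hinv hsqrt
  rw [costCoeff, mul_assoc (2 * κhi)]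
  exact le_mul_of_one_le_right (by linarith) h1

/-! ### Cauchy–Schwarz for the inverse Gram form -/

theorem inner_mem_Icc {E : Type*} [NormedAddCommGroup E] [InnerProductSpace ℝ E] {u v : E}
    (hu : ‖u‖ ≤ 1) (hv : ‖v‖ ≤ 1) : inner ℝ u v ∈ Icc (-1 : ℝ) 1 :=
  abs_le.1 ((abs_real_inner_le_norm u v).trans (mul_le_one₀ hu (norm_nonneg v) hv))

/-- A positive semidefinite form bounds the pairing with each of its fixed vectors. -/
theorem abs_inner_le_mahalanobis {d : ℕ} {B : Mat d} (hB : B.PosSemidef) {v : Vec d}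
    (hv : B.mulVec v.ofLp = v.ofLp) (x : Vec d) :
    |inner ℝ x v| ≤ ‖v‖ * mahalanobis B x := by
  have hinner : inner ℝ x v = x.ofLp ⬝ᵥ v.ofLp := by
    rw [EuclideanSpace.inner_eq_star_dotProduct, star_trivial, dotProduct_comm]
  have hnorm : v.ofLp ⬝ᵥ v.ofLp = ‖v‖ ^ 2 := by
    rw [← real_inner_self_eq_norm_sq, EuclideanSpace.inner_eq_star_dotProduct, star_trivial]
  have hsymm : v.ofLp ⬝ᵥ B.mulVec x.ofLp = x.ofLp ⬝ᵥ v.ofLp := by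
    have hBt : B.transpose = B := by
      simpa [Matrix.IsHermitian, Matrix.conjTranspose_eq_transpose_of_trivial] using hB.isHermitian
    rw [Matrix.dotProduct_mulVec, ← Matrix.mulVec_transpose, hBt, hv, dotProduct_comm]
  have hq : ∀ w : Fin d → ℝ, 0 ≤ w ⬝ᵥ B.mulVec w := fun w => by
    simpa using hB.dotProduct_mulVec_nonneg w
  -- This is the form of `B` at x + t v. Since `B` is symmetric and fixes v, its cross term is ⟨x,
  -- v⟩ and its leading coefficient ‖v‖². Nonnegativity for all t makes the discriminant
  -- nonpositive.
  have hquad : ∀ t : ℝ, 0 ≤ ‖v‖ ^ 2 * (t * t) + 2 * inner ℝ x v * t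
      + x.ofLp ⬝ᵥ B.mulVec x.ofLp := by
    intro t
    have h := hq (x.ofLp + t • v.ofLp)
    rw [Matrix.mulVec_add, Matrix.mulVec_smul, hv, add_dotProduct, dotProduct_add, dotProduct_add,
      smul_dotProduct, smul_dotProduct, dotProduct_smul, dotProduct_smul, hsymm, hnorm,
      ← hinner] at h
    simp only [smul_eq_mul] at h
    linarith
  have hd := discrim_le_zero hquad
  rw [discrim] at hd
  rw [mahalanobis, ← abs_of_nonneg (mul_nonneg (norm_nonneg v) (Real.sqrt_nonneg _)), ← sq_le_sq,
    mul_pow, Real.sq_sqrt (hq _)]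
  linarith

/-! ### Least squares on exact cost observations -/

namespace Trajectory

variable {S A : Type*} {d : ℕ}

theorem gram_posDef (φ : S → A → Vec d) (x : Trajectory S A d) (h t : ℕ) :
    (x.gram φ h t).PosDef := by
  refine Matrix.PosDef.one.add_posSemidef (Matrix.posSemidef_sum _ fun τ _ => ?_)
  simpa using Matrix.posSemidef_vecMulVec_self_star (φ (x.state τ h) (x.action τ h)).ofLp

/-- The Gram matrix, hence its inverse, fixes the vectors orthogonal to all the visited features. -/
theorem gram_inv_mulVec_of_inner_eq_zero (φ : S → A → Vec d) (x : Trajectory S A d) (h t : ℕ)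
    {v : Vec d} (hv : ∀ τ ∈ x.visits h t, inner ℝ (φ (x.state τ h) (x.action τ h)) v = 0) :
    (x.gram φ h t)⁻¹.mulVec v.ofLp = v.ofLp := by
  have hfix : (x.gram φ h t).mulVec v.ofLp = v.ofLp := by
    rw [gram, Matrix.add_mulVec, Matrix.one_mulVec, Matrix.sum_mulVec, Finset.sum_eq_zero, add_zero]
    intro τ hτ
    have h0 := hv τ hτ
    rw [EuclideanSpace.inner_eq_star_dotProduct, star_trivial, dotProduct_comm] at h0
    rw [Matrix.vecMulVec_mulVec, h0]
    simp
  have hdet : IsUnit (x.gram φ h t).det := (x.gram_posDef φ h t).det_pos.ne'.isUnit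
  conv_lhs => rw [← hfix]
  rw [Matrix.mulVec_mulVec, Matrix.nonsing_inv_mul _ hdet, Matrix.one_mulVec]

/-- The observed safety costs being exact, a constrained least-squares estimate reproduces them. -/
theorem glm_eq_of_lossG_le (φ : S → A → Vec d) (f : ℝ → ℝ) {g : S → A → ℝ}
    (x : Trajectory S A d) (h t : ℕ) {θ θ' : Vec d} (hg : g = glm φ f θ)
    (hle : x.lossG φ f g h t θ' ≤ x.lossG φ f g h t θ) :
    ∀ τ ∈ x.visits h t, glm φ f θ (x.state τ h) (x.action τ h)
      = glm φ f θ' (x.state τ h) (x.action τ h) := by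
  have h0 : x.lossG φ f g h t θ = 0 := by simp [lossG, hg]
  have h1 : x.lossG φ f g h t θ' = 0 :=
    le_antisymm (hle.trans h0.le) (Finset.sum_nonneg fun _ _ => sq_nonneg _)
  intro τ hτ
  have h2 := (Finset.sum_eq_zero_iff_of_nonneg fun _ _ => sq_nonneg _).1 h1 τ hτ
  rw [hg] at h2
  exact sub_eq_zero.1 (pow_eq_zero_iff two_ne_zero |>.1 h2)

/-- Confidence bound for a constrained least-squares estimate of the safety cost. -/
theorem le_glm_add_width [MeasurableSpace S] [MeasurableSpace A] {φ : S → A → Vec d}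
    (hφ : FeatureMap φ) {f : ℝ → ℝ} {κlo κhi M : ℝ} (hf : RegularLink f κlo κhi M)
    {g : S → A → ℝ} (hg : g ∈ glmClass φ f) {Cg : ℝ} (hCg : 2 * κhi ≤ Cg)
    (x : Trajectory S A d) (h t : ℕ) (hball : ‖x.thetaG h t‖ ≤ 1)
    (hmin : ∀ θ : Vec d, ‖θ‖ ≤ 1 → x.lossG φ f g h t (x.thetaG h t) ≤ x.lossG φ f g h t θ)
    (s : S) (a : A) :
    g s a ≤ glm φ f (x.thetaG h t) s a + x.width φ Cg h t s a := by
  obtain ⟨θ, hθ, hgθ⟩ := hg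
  have hfit := x.glm_eq_of_lossG_le φ f h t hgθ (hmin θ hθ)
  have hIcc : ∀ s a, ∀ θ : Vec d, ‖θ‖ ≤ 1 → inner ℝ (φ s a) θ ∈ Icc (-1 : ℝ) 1 :=
    fun s a θ hθ => inner_mem_Icc (hφ.norm_le s a) hθ
  have horth : ∀ τ ∈ x.visits h t,
      inner ℝ (φ (x.state τ h) (x.action τ h)) (θ - x.thetaG h t) = 0 := by
    intro τ hτ
    rw [inner_sub_right, sub_eq_zero]
    exact hf.injOn (hIcc _ _ _ hθ) (hIcc _ _ _ hball) (hfit τ hτ)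
  have hbound := abs_inner_le_mahalanobis (x.gram_posDef φ h t).inv.posSemidef
    (x.gram_inv_mulVec_of_inner_eq_zero φ h t horth) (φ s a)
  rw [inner_sub_right] at hbound
  -- The diameter of the parameter ball: the source of the constant C = 2.
  have hnorm : ‖θ - x.thetaG h t‖ ≤ 2 := (norm_sub_le _ _).trans (by linarith)
  have hκ : 0 < κhi := hf.κlo_pos.trans hf.κlo_lt
  have hm : 0 ≤ mahalanobis (x.gram φ h t)⁻¹ (φ s a) := Real.sqrt_nonneg _
  have hdiff : glm φ f θ s a - glm φ f (x.thetaG h t) s a ≤ x.width φ Cg h t s a :=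
    calc glm φ f θ s a - glm φ f (x.thetaG h t) s a
        ≤ κhi * |inner ℝ (φ s a) θ - inner ℝ (φ s a) (x.thetaG h t)| :=
          (le_abs_self _).trans (hf.abs_sub_le (hIcc s a _ hball) (hIcc s a _ hθ))
      _ ≤ κhi * (2 * mahalanobis (x.gram φ h t)⁻¹ (φ s a)) := by
          gcongr
          exact hbound.trans (by gcongr)
      _ = 2 * κhi * mahalanobis (x.gram φ h t)⁻¹ (φ s a) := by ring
      _ ≤ x.width φ Cg h t s a := by
          rw [width]
          gcongr
  rw [hgθ]
  linarith

end Trajectory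

end GLMMase

open GLMMase in
theorem mainTheorem4 :
    ∃ C : ℝ, 0 < C ∧
      ∀ (S A Ω : Type*) [MeasurableSpace S] [MeasurableSpace A] [MeasurableSpace Ω]
        (μ : Measure Ω) [IsProbabilityMeasure μ]
        (d : ℕ) (_hd : 0 < d) (𝓜 : CMDP S A)
        (φ : S → A → Vec d) (_hφ : FeatureMap φ)
        (f : ℝ → ℝ) (κlo κhi M : ℝ) (_hf : RegularLink f κlo κhi M)
        (αmax : ℝ) (_hα : 0 < αmax) (_hGL : IsGLCMDP 𝓜 φ f αmax)
        (T : ℕ) (_hT : 0 < T) (δ : ℝ) (_hδ : δ = 1 / ((T : ℝ) * (𝓜.H : ℝ)))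
        (CQ c : ℝ) (_hCQ : 0 < CQ) (_hc : 0 < c)
        (X : Ω → Trajectory S A d)
        (_hX : IsGLMMaseProcess 𝓜 φ f (costCoeff C κlo κhi M αmax δ d) CQ c T μ X),
        1 - δ ≤ μ.real {ω | ∀ t ∈ Finset.Icc 1 T, ∀ h ∈ Finset.Icc 1 𝓜.H,
          h ≤ (X ω).len t →
            𝓜.g ((X ω).state t h) ((X ω).action t h) ≤ (X ω).threshold t h} := by

  refine ⟨2, two_pos, ?_⟩
  intro S A Ω _ _ _ μ _ d _ 𝓜 φ hφ f κlo κhi M hf αmax hα hGL T hT δ hδ CQ c _ _ X hX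
  have hTH : (1 : ℝ) ≤ (T : ℝ) * (𝓜.H : ℝ) := by
    exact_mod_cast Nat.mul_pos hT 𝓜.H_pos
  have hδ0 : 0 < δ := by
    rw [hδ]
    positivity
  have hδ1 : δ ≤ 1 := by
    rw [hδ]
    exact (div_le_one (by positivity)).2 hTH
  have hCg := hf.two_mul_le_costCoeff hα hδ0 hδ1 d
  have hae : ∀ᵐ ω ∂μ, ω ∈ {ω | ∀ t ∈ Finset.Icc 1 T, ∀ h ∈ Finset.Icc 1 𝓜.H,
      h ≤ (X ω).len t →
        𝓜.g ((X ω).state t h) ((X ω).action t h) ≤ (X ω).threshold t h} := by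
    filter_upwards [hX.follows] with ω hω t ht h hh hlen
    -- Episode t uses the estimate indexed t - 1. For t = 1 there are no data: the loss is an empty
    -- sum and Λ is the identity, and the confidence bound still applies.
    obtain ⟨hball, hmin⟩ :=
      hω.thetaG_argmin (t - 1) ((Nat.sub_le t 1).trans (Finset.mem_Icc.1 ht).2) h hh
    -- Capping the upper bound at 1 is harmless because g ≤ 1.
    exact (le_min (𝓜.g_mem _ _).2
      (Trajectory.le_glm_add_width hφ hf hGL.cost_mem hCg (X ω) h (t - 1) hball hmin _ _)).trans
      (hω.action_safe t ht h (Finset.mem_Icc.2 ⟨(Finset.mem_Icc.1 hh).1, hlen⟩))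
  have hone : μ {ω | ∀ t ∈ Finset.Icc 1 T, ∀ h ∈ Finset.Icc 1 𝓜.H,
      h ≤ (X ω).len t →
        𝓜.g ((X ω).state t h) ((X ω).action t h) ≤ (X ω).threshold t h} = 1 :=
    (measure_congr (Filter.eventuallyEq_univ.2 hae)).trans measure_univ
  rw [measureReal_def, hone, ENNReal.toReal_one]
  linarith
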